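/- Let $\mathfrak g$ be a finite-dimensional complex simple Lie algebra with invariant form $(x,y)=\frac1{2h^\vee}\operatorname{Tr}(\operatorname{ad}x\,\operatorname{ad}y)$, $h^\vee$ the dual Coxeter number, and let $k\in\mathbb C$. Let $V^k(\mathfrak g)$ be the universal affine vertex algebra of level $k$, i.e. the module over $\hat{\mathfrak g}=\mathfrak g[t,t^{-1}]\oplus\mathbb CK$ induced from the one-dimensional $(\mathfrak g[t]\oplus\mathbb CK)$-module on which $\mathfrak g[t]$ acts by $0$ and $K$ by $k$, with vacuum $|0\rangle=1\otimes 1$ and state-field correspondence determined by $Y(J_x,z)=\sum_{n\in\mathbb Z}(xt^n)z^{-n-1}$, where $J_x=(xt^{-1})|0\rangle$, $x\in\mathfrak g$. Let $M_1,M_2,M_3$ be $V^k(\mathfrak g)$-modules (with translation operators $T$). On each of them let $xt^n$ act as the mode $(J_x)_{(n)}$, write $xa=(xt^0)a$, and put $[v_\lambda a]=\sum_{n\ge0}\frac{\lambda^n}{n!}v_{(n)}a$ for $v\in V^k(\mathfrak g)$. Let $\mathcal Y$ be an intertwining operator of type $\binom{M_3}{M_1\ M_2}$, that is, a linear map $a\mapsto\mathcal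 Y(a,z)=\sum_{n\in\mathbb C}a_{(n)}z^{-n-1}$ from $M_1$ to $\operatorname{Hom}(M_2,M_3[\![z]\!]z^{-\Gamma})$, where $\Gamma\subset\mathbb C$, $\Gamma+\mathbb Z=\Gamma$ and $\Gamma/\mathbb Z$ is finite, satisfying $[T,\mathcal Y(a,z)]=\mathcal Y(Ta,z)=\partial_z\mathcal Y(a,z)$ and the Jacobi identity. For $A\subseteq M_1$ and $B\subseteq M_2$, call $m_1,\dots,m_d\in\Gamma$, pairwise incongruent modulo $\mathbb Z$, *expansion exponents on $A\times B$* if $$\mathcal Y(a,z)b=\sum_{i=1}^d\sum_{n\ge0}a_{(m_i-n)}b\,z^{-m_i+n-1}\qquad\text{for all }a\in A,\ b\in B.$$ Consider, for a vector $a$ of a $V^k(\mathfrak g)$-module, the condition $$[{J_x}_\lambda a]=xa\quad\text{for all }x\in\mathfrak g.\tag{$*$}$$ (1) Let $a\in M_1$ and $b\in M_2$ satisfy $(*)$ and let $m_1,\dots,m_d$ be expansion exponents on $(\{a\}\cup\{xa: x\in\mathfrak g\})\times\{b\}$. Then for all $i$ and all $x\in\mathfrak g$ $$[{J_x}_\lambda\,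 a_{(m_i)}b]=(xa)_{(m_i)}b+a_{(m_i)}(xb),$$ i.e. $a_{(m_i)}b$ satisfies $(*)$, with $x\,(a_{(m_i)}b)=(xa)_{(m_i)}b+a_{(m_i)}(xb)$. (2) Hence these vectors carry the tensor-product action of $\mathfrak g$: let $E_1\subseteq M_1$ and $E_2\subseteq M_2$ be subspaces that are $\mathfrak g$-modules, with $[{J_x}_\lambda e]=xe$ for all $x\in\mathfrak g$ and $e\in E_j$ ($j=1,2$), and let $m_1,\dots,m_d$ be expansion exponents on $E_1\times E_2$. Then for every $i$ the linear map $\Phi_i\colon E_1\otimes E_2\to M_3$, $\Phi_i(a\otimes b)=a_{(m_i)}b$, satisfies $[{J_x}_\lambda\Phi_i(t)]=\Phi_i(x\cdot t)$ for all $x\in\mathfrak g$ and $t\in E_1\otimes E_2$, where $x\cdot(a\otimes b)=xa\otimes b+a\otimes xb$; and the image of $\Phi_i$ is a $\mathfrak g$-module with $x\,\Phi_i(t)=\Phi_i(x\cdot t)$. -/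

import Mathlib

open scoped VertexOperator TensorProduct

namespace AffineVertex

/-! ### Products of fields -/

noncomputable section

/-- The field with prescribed Fourier modes `A_(n)`. -/
def fieldOfModes {V : Type*} [AddCommGroup V] [Module ℂ V] (f : ℤ → Module.End ℂ V)
    (hf : ∀ v, ∃ N : ℤ, ∀ n ≥ N, f n v = 0) : VertexOperator ℂ V :=
  VertexOperator.of_coeff (fun n => f (-n - 1)) fun v => by
    obtain ⟨N, hN⟩ := hf v
    refine ⟨-N, fun n hn => ?_⟩
    by_contra h
    exact hn (hN _ (by omega))

section
variable {V : Type*} [AddCommGroup V] [Module ℂ V]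

@[simp] theorem ncoeff_fieldOfModes (f : ℤ → Module.End ℂ V)
    (hf : ∀ v, ∃ N : ℤ, ∀ n ≥ N, f n v = 0) (n : ℤ) : (fieldOfModes f hf)[[n]] = f n := by
  simp [fieldOfModes]

theorem field_ext {A B : VertexOperator ℂ V} (h : ∀ n v, (A[[n]]) v = (B[[n]]) v) : A = B := by
  apply HVertexOperator.coeff_inj
  funext n
  rw [VertexOperator.coeff_eq_ncoeff, VertexOperator.coeff_eq_ncoeff]
  exact LinearMap.ext (h _)

theorem field_trunc (A : VertexOperator ℂ V) (v : V) : ∃ N : ℤ, ∀ n ≥ N, (A[[n]]) v = 0 :=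
  ⟨-((HahnModule.of ℂ).symm (A v)).order, fun n hn =>
    VertexOperator.ncoeff_eq_zero_of_lt_order A n v (by omega)⟩

theorem finsum_trunc {W : Type*} [AddCommGroup W] {f : ℕ → W} {N : ℕ} (h : ∀ j ≥ N, f j = 0) :
    ∑ᶠ j, f j = ∑ j ∈ Finset.range N, f j :=
  finsum_eq_sum_of_support_subset _ fun j hj => by
    simp only [Finset.coe_range, Set.mem_Iio]
    by_contra h'
    exact hj (h j (by omega))

theorem field_trunc_nat (A : VertexOperator ℂ V) (m : ℤ) (v : V) :
    ∃ N : ℕ, ∀ j : ℕ, j ≥ N → (A[[m + j]]) v = 0 := by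
  obtain ⟨N, hN⟩ := field_trunc A v
  exact ⟨(N - m).toNat, fun j hj => hN _ (by omega)⟩

/-- The scalar `(-1)^j * binom(n, j)`. -/
def cf (n : ℤ) (j : ℕ) : ℂ := (-1) ^ j * ((Ring.choose n j : ℤ) : ℂ)

/-- `Res_z X(z) A(w) ι_{z,w} (z-w)^n`, as a field in `w`. -/
def leftProd (X : VertexOperator ℂ V) (n : ℤ) (A : VertexOperator ℂ V) : VertexOperator ℂ V :=
  fieldOfModes
    (fun m =>
      { toFun := fun v => ∑ᶠ j : ℕ, cf n j • (X[[n - j]]) ((A[[m + j]]) v)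
        map_add' := fun u v => by
          obtain ⟨N, hN⟩ := field_trunc_nat A m u
          obtain ⟨M, hM⟩ := field_trunc_nat A m v
          rw [finsum_trunc (N := max N M), finsum_trunc (N := max N M), finsum_trunc (N := max N M),
            ← Finset.sum_add_distrib]
          · simp
          all_goals intro j hj; simp [hN j (by omega), hM j (by omega)]
        map_smul' := fun c v => by
          obtain ⟨M, hM⟩ := field_trunc_nat A m v
          rw [finsum_trunc (N := M), finsum_trunc (N := M), RingHom.id_apply, Finset.smul_sum]
          · refine Finset.sum_congr rfl fun j _ => ?_
            simp [smul_comm c]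
          all_goals intro j hj; simp [hM j (by omega)] })
    fun v => by
      obtain ⟨N, hN⟩ := field_trunc A v
      refine ⟨N, fun m hm => ?_⟩
      have h : ∀ j : ℕ, (A[[m + j]]) v = 0 := fun j => hN _ (by omega)
      simp [h]

/-- `Res_z A(w) X(z) ι_{w,z} (z-w)^n`, as a field in `w`. -/
def rightProd (X : VertexOperator ℂ V) (n : ℤ) (A : VertexOperator ℂ V) : VertexOperator ℂ V :=
  fieldOfModes
    (fun m =>
      { toFun := fun v => ∑ᶠ j : ℕ, ((-1) ^ n * cf n j) • (A[[n + m - j]]) ((X[[(j : ℤ)]]) v)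
        map_add' := fun u v => by
          obtain ⟨N, hN⟩ := field_trunc_nat X 0 u
          obtain ⟨M, hM⟩ := field_trunc_nat X 0 v
          simp only [zero_add] at hN hM
          rw [finsum_trunc (N := max N M), finsum_trunc (N := max N M), finsum_trunc (N := max N M),
            ← Finset.sum_add_distrib]
          · simp
          all_goals intro j hj; simp [hN j (by omega), hM j (by omega)]
        map_smul' := fun c v => by
          obtain ⟨M, hM⟩ := field_trunc_nat X 0 v
          simp only [zero_add] at hM
          rw [finsum_trunc (N := M), finsum_trunc (N := M), RingHom.id_apply, Finset.smul_sum]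
          · refine Finset.sum_congr rfl fun j _ => ?_
            simp only [map_smul]
            rw [smul_comm]
          all_goals intro j hj; simp [hM j (by omega)] })
    fun v => by
      obtain ⟨M, hM⟩ := field_trunc_nat X 0 v
      simp only [zero_add] at hM
      choose N hN using fun j : ℕ => field_trunc A ((X[[(j : ℤ)]]) v)
      obtain ⟨P, hP⟩ := ((Finset.range M).image N).exists_le
      refine ⟨P - n + M, fun m hm => ?_⟩
      have h : ∀ j : ℕ, (A[[n + m - j]]) ((X[[(j : ℤ)]]) v) = 0 := fun j => by
        by_cases hj : j < M
        · have := hP (N j) (Finset.mem_image_of_mem _ (Finset.mem_range.2 hj))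
          exact hN j _ (by omega)
        · rw [hM j (by omega), map_zero]
      simp [h]

theorem leftProd_apply (X A : VertexOperator ℂ V) (n m : ℤ) (v : V) {N : ℕ}
    (hN : ∀ j : ℕ, j ≥ N → (A[[m + j]]) v = 0) :
    ((leftProd X n A)[[m]]) v =
      ∑ j ∈ Finset.range N, cf n j • (X[[n - j]]) ((A[[m + j]]) v) := by
  rw [leftProd, ncoeff_fieldOfModes]
  exact finsum_trunc fun j hj => by simp [hN j hj]

theorem rightProd_apply (X A : VertexOperator ℂ V) (n m : ℤ) (v : V) {N : ℕ}
    (hN : ∀ j : ℕ, j ≥ N → (X[[(j : ℤ)]]) v = 0) :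
    ((rightProd X n A)[[m]]) v =
      ∑ j ∈ Finset.range N, ((-1) ^ n * cf n j) • (A[[n + m - j]]) ((X[[(j : ℤ)]]) v) := by
  rw [rightProd, ncoeff_fieldOfModes]
  exact finsum_trunc fun j hj => by simp [hN j hj]

theorem trunc0 (X : VertexOperator ℂ V) (v : V) :
    ∃ N : ℕ, ∀ j : ℕ, j ≥ N → (X[[(j : ℤ)]]) v = 0 := by
  simpa using field_trunc_nat X 0 v

theorem ncoeff_add (A B : VertexOperator ℂ V) (n : ℤ) (v : V) :
    ((A + B)[[n]]) v = (A[[n]]) v + (B[[n]]) v := by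
  rw [map_add]; rfl

theorem ncoeff_sub (A B : VertexOperator ℂ V) (n : ℤ) (v : V) :
    ((A - B)[[n]]) v = (A[[n]]) v - (B[[n]]) v := by
  rw [map_sub]; rfl

theorem ncoeff_smul (c : ℂ) (A : VertexOperator ℂ V) (n : ℤ) (v : V) :
    ((c • A)[[n]]) v = c • (A[[n]]) v := by
  rw [map_smul]; rfl

/-- `leftProd` as a bilinear map. -/
def leftProdL (n : ℤ) :
    VertexOperator ℂ V →ₗ[ℂ] VertexOperator ℂ V →ₗ[ℂ] VertexOperator ℂ V :=
  LinearMap.mk₂ ℂ (fun X A => leftProd X n A)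
    (fun X Y A => field_ext fun m v => by
      obtain ⟨N, hN⟩ := field_trunc_nat A m v
      simp only [leftProd_apply _ A _ _ _ hN, ncoeff_add, smul_add, Finset.sum_add_distrib])
    (fun c X A => field_ext fun m v => by
      obtain ⟨N, hN⟩ := field_trunc_nat A m v
      simp only [leftProd_apply _ A _ _ _ hN, ncoeff_smul, smul_comm _ c, Finset.smul_sum])
    (fun X A B => field_ext fun m v => by
      obtain ⟨N, hN⟩ := field_trunc_nat A m v
      obtain ⟨M, hM⟩ := field_trunc_nat B m v
      rw [ncoeff_add, leftProd_apply _ A _ _ _ (N := max N M) fun j hj => hN j (by omega),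
        leftProd_apply _ B _ _ _ (N := max N M) fun j hj => hM j (by omega),
        leftProd_apply _ (A + B) _ _ _ (N := max N M) fun j hj => by
          rw [ncoeff_add, hN j (by omega), hM j (by omega), add_zero] ]
      simp only [ncoeff_add]
      simp only [map_add, smul_add, Finset.sum_add_distrib])
    (fun c X A => field_ext fun m v => by
      obtain ⟨N, hN⟩ := field_trunc_nat A m v
      rw [ncoeff_smul, leftProd_apply _ A _ _ _ hN,
        leftProd_apply _ (c • A) _ _ _ (N := N) fun j hj => by
          rw [ncoeff_smul, hN j hj, smul_zero] ]
      simp only [ncoeff_smul]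
      simp only [map_smul, smul_comm _ c, Finset.smul_sum])

/-- `rightProd` as a bilinear map. -/
def rightProdL (n : ℤ) :
    VertexOperator ℂ V →ₗ[ℂ] VertexOperator ℂ V →ₗ[ℂ] VertexOperator ℂ V :=
  LinearMap.mk₂ ℂ (fun X A => rightProd X n A)
    (fun X Y A => field_ext fun m v => by
      obtain ⟨N, hN⟩ := trunc0 X v
      obtain ⟨M, hM⟩ := trunc0 Y v
      rw [ncoeff_add, rightProd_apply X _ _ _ _ (N := max N M) fun j hj => hN j (by omega),
        rightProd_apply Y _ _ _ _ (N := max N M) fun j hj => hM j (by omega),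
        rightProd_apply (X + Y) _ _ _ _ (N := max N M) fun j hj => by
          rw [ncoeff_add, hN j (by omega), hM j (by omega), add_zero] ]
      simp only [ncoeff_add]
      simp only [map_add, smul_add, Finset.sum_add_distrib])
    (fun c X A => field_ext fun m v => by
      obtain ⟨N, hN⟩ := trunc0 X v
      rw [ncoeff_smul, rightProd_apply X _ _ _ _ hN,
        rightProd_apply (c • X) _ _ _ _ (N := N) fun j hj => by
          rw [ncoeff_smul, hN j hj, smul_zero] ]
      simp only [ncoeff_smul]
      simp only [map_smul, smul_comm _ c, Finset.smul_sum])
    (fun X A B => field_ext fun m v => by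
      obtain ⟨N, hN⟩ := trunc0 X v
      simp only [rightProd_apply X _ _ _ _ hN, ncoeff_add, smul_add, Finset.sum_add_distrib])
    (fun c X A => field_ext fun m v => by
      obtain ⟨N, hN⟩ := trunc0 X v
      simp only [rightProd_apply X _ _ _ _ hN, ncoeff_smul, smul_comm _ c, Finset.smul_sum])

/-- The `n`-th product of fields,
`X(w)_(n) A(w) = Res_z (X(z) A(w) ι_{z,w} (z-w)^n - A(w) X(z) ι_{w,z} (z-w)^n)`;
for `n = -1-r` it is the normally ordered product `:∂^(r) X(w) A(w):`. -/
def nthProd (n : ℤ) :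
    VertexOperator ℂ V →ₗ[ℂ] VertexOperator ℂ V →ₗ[ℂ] VertexOperator ℂ V :=
  LinearMap.mk₂ ℂ (fun X A => leftProd X n A - rightProd X n A)
    (fun X Y A => by
      have h1 := (leftProdL n).map_add₂ X Y A
      have h2 := (rightProdL n).map_add₂ X Y A
      simp only [leftProdL, rightProdL, LinearMap.mk₂_apply] at h1 h2
      rw [h1, h2]; abel)
    (fun c X A => by
      have h1 := (leftProdL n).map_smul₂ c X A
      have h2 := (rightProdL n).map_smul₂ c X A
      simp only [leftProdL, rightProdL, LinearMap.mk₂_apply] at h1 h2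
      rw [h1, h2, smul_sub])
    (fun X A B => by
      have h1 := (leftProdL n X).map_add A B
      have h2 := (rightProdL n X).map_add A B
      simp only [leftProdL, rightProdL, LinearMap.mk₂_apply] at h1 h2
      rw [h1, h2]; abel)
    (fun c X A => by
      have h1 := (leftProdL n X).map_smul c A
      have h2 := (rightProdL n X).map_smul c A
      simp only [leftProdL, rightProdL, LinearMap.mk₂_apply] at h1 h2
      rw [h1, h2, smul_sub])

theorem nthProd_eq (n : ℤ) (X A : VertexOperator ℂ V) :
    nthProd n X A = leftProd X n A - rightProd X n A := rfl

theorem left_right_comm (X Y A : VertexOperator ℂ V) (n m : ℤ) :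
    leftProd X n (rightProd Y m A) = rightProd Y m (leftProd X n A) := by
  refine field_ext fun p v => ?_
  obtain ⟨M, hM⟩ := trunc0 Y v
  choose N hN using fun j : ℕ => field_trunc A ((Y[[(j : ℤ)]]) v)
  obtain ⟨P, hP⟩ := ((Finset.range M).image N).exists_le
  set Q : ℕ := (P - m - p + M).toNat with hQ
  have h1 : ∀ j : ℕ, ∀ i : ℕ, i ≥ Q → (A[[m + p - j + i]]) ((Y[[(j : ℤ)]]) v) = 0 :=
    fun j i hi => by
      by_cases hj : j < M
      · have := hP (N j) (Finset.mem_image_of_mem _ (Finset.mem_range.2 hj))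
        exact hN j _ (by omega)
      · rw [hM j (by omega), map_zero]
  have e : ∀ i j : ℕ, m + (p + (i : ℤ)) - (j : ℤ) = m + p - j + i := fun i j => by ring
  rw [leftProd_apply _ _ _ _ _ (N := Q) fun i hi => by
      rw [rightProd_apply _ _ _ _ _ hM]
      refine Finset.sum_eq_zero fun j _ => ?_
      rw [e, h1 j i hi, smul_zero], rightProd_apply _ _ _ _ _ hM]
  simp only [rightProd_apply _ _ _ _ _ hM, e, map_sum, map_smul, Finset.smul_sum]
  rw [Finset.sum_comm]
  refine Finset.sum_congr rfl fun j _ => ?_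
  rw [leftProd_apply _ _ _ _ _ (h1 j), Finset.smul_sum]
  exact Finset.sum_congr rfl fun i _ => smul_comm _ _ _

theorem sum_square_eq {W : Type*} [AddCommGroup W] (f : ℕ → ℕ → W) (N : ℕ) (h : ∀ i j, N ≤ i + j → f i j = 0) :
    ∑ i ∈ Finset.range N, ∑ j ∈ Finset.range N, f i j =
      ∑ l ∈ Finset.range N, ∑ p ∈ Finset.HasAntidiagonal.antidiagonal l, f p.1 p.2 := by
  have : ∀ l, ∑ p ∈ Finset.HasAntidiagonal.antidiagonal l, f p.1 p.2 = ∑ i ∈ Finset.range (l + 1), f i (l - i) :=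
    fun l => Finset.Nat.sum_antidiagonal_eq_sum_range_succ f l
  simp only [this]
  rw [Finset.sum_range_diag_flip]
  refine Finset.sum_congr rfl fun i hi => ?_
  symm
  refine Finset.sum_subset (fun j hj => ?_) fun j _ hj' => h i j ?_
  · simp only [Finset.mem_range] at *; omega
  · simp only [Finset.mem_range] at *; omega

theorem cf_conv (n m : ℤ) (l : ℕ) :
    ∑ p ∈ Finset.HasAntidiagonal.antidiagonal l, cf n p.1 * cf m p.2 = cf (n + m) l := by
  simp only [cf]
  rw [Ring.add_choose_eq l (Commute.all n m)]
  rw [Int.cast_sum, Finset.mul_sum]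
  refine Finset.sum_congr rfl fun p hp => ?_
  rw [← Finset.HasAntidiagonal.mem_antidiagonal.1 hp, pow_add, Int.cast_mul]
  ring

theorem cf_shift (n : ℤ) (i : ℕ) : ((n : ℂ) - i) * cf n i = n * cf (n - 1) i := by
  have : (n - i) * Ring.choose n i = n * Ring.choose (n - 1) i := by
    cases i with
    | zero => simp
    | succ i =>
      have h1 := Ring.choose_succ_succ (n - 1) i
      have h2 : (i + 1 : ℕ) • Ring.choose n (i + 1) = n * Ring.choose (n - 1) i := by
        have h3 := Ring.choose_smul_choose n (n := i + 1) (k := 1) (by omega)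
        simpa using h3
      rw [sub_add_cancel] at h1
      simp only [nsmul_eq_mul] at h2
      rw [sub_mul, h2, h1]; ring
  have h : ((n : ℂ) - i) * ((Ring.choose n i : ℤ) : ℂ) = n * ((Ring.choose (n - 1) i : ℤ) : ℂ) := by
    exact_mod_cast this
  simp only [cf]
  linear_combination ((-1 : ℂ) ^ i) * h

theorem cf_central (n m : ℤ) (l : ℕ) (hl : n + m = l) :
    ∑ p ∈ Finset.HasAntidiagonal.antidiagonal l, cf n p.1 * cf m p.2 * ((n : ℂ) - p.1) =
      if n + m = 0 then (n : ℂ) else 0 := by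
  have : ∀ p : ℕ × ℕ, cf n p.1 * cf m p.2 * ((n : ℂ) - p.1) = n * (cf (n - 1) p.1 * cf m p.2) :=
    fun p => by rw [← mul_assoc, ← cf_shift]; ring
  simp only [this, ← Finset.mul_sum, cf_conv]
  rw [show n - 1 + m = (l : ℤ) - 1 by omega, cf]
  cases l with
  | zero => simp [hl]
  | succ l =>
    have : ((l + 1 : ℕ) : ℤ) - 1 = (l : ℤ) := by omega
    rw [this, Ring.choose_natCast, Nat.choose_succ_self, if_neg (by omega)]
    simp

/-- The commutation relations `[X_(a), Y_(b)] = Z_(a+b) + a κ δ_{a,-b}` of three fields. -/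
def CurrentOPE (X Y Z : VertexOperator ℂ V) (κ : ℂ) : Prop :=
  ∀ (a b : ℤ) (v : V), (X[[a]]) ((Y[[b]]) v) - (Y[[b]]) ((X[[a]]) v) =
    (Z[[a + b]]) v + if a + b = 0 then ((a : ℂ) * κ) • v else 0

theorem left_left {X Y Z : VertexOperator ℂ V} {κ : ℂ} (h : CurrentOPE X Y Z κ) (n m : ℤ)
    (A : VertexOperator ℂ V) :
    leftProd X n (leftProd Y m A) - leftProd Y m (leftProd X n A) =
      leftProd Z (n + m) A + if n + m = 0 then ((n : ℂ) * κ) • A else 0 := by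
  refine field_ext fun p v => ?_
  obtain ⟨N, hN⟩ := field_trunc_nat A p v
  have h0 : ∀ i j : ℕ, N ≤ i + j → (A[[p + i + j]]) v = 0 := fun i j hij => by
    have := hN (i + j) hij
    rwa [Nat.cast_add, ← add_assoc] at this
  have key : ∀ (X Y : VertexOperator ℂ V) (n m : ℤ), ((leftProd X n (leftProd Y m A))[[p]]) v =
      ∑ i ∈ Finset.range N, ∑ j ∈ Finset.range N,
        (cf n i * cf m j) • (X[[n - i]]) ((Y[[m - j]]) ((A[[p + i + j]]) v)) := fun X Y n m => by
    have h1 : ∀ i : ℕ, ((leftProd Y m A)[[p + i]]) v = ∑ j ∈ Finset.range N,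
        cf m j • (Y[[m - j]]) ((A[[p + i + j]]) v) := fun i =>
      leftProd_apply _ _ _ _ _ fun j hj => h0 i j (by omega)
    rw [leftProd_apply _ _ _ _ _ (N := N) fun i hi => by
      rw [h1]
      exact Finset.sum_eq_zero fun j _ => by rw [h0 i j (by omega), map_zero, smul_zero] ]
    simp only [h1, map_sum, map_smul, Finset.smul_sum, mul_smul]
  have hc : ((if n + m = 0 then ((n : ℂ) * κ) • A else 0 : VertexOperator ℂ V)[[p]]) v =
      if n + m = 0 then ((n : ℂ) * κ) • (A[[p]]) v else 0 := by
    split_ifs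
    · rw [ncoeff_smul]
    · rw [map_zero]; rfl
  rw [ncoeff_sub, key, key, Finset.sum_comm (f := fun i j : ℕ =>
      (cf m i * cf n j) • (Y[[m - i]]) ((X[[n - j]]) ((A[[p + i + j]]) v))),
    ← Finset.sum_sub_distrib]
  simp only [← Finset.sum_sub_distrib]
  have step : ∀ i j : ℕ, (cf n i * cf m j) • (X[[n - i]]) ((Y[[m - j]]) ((A[[p + i + j]]) v)) -
      (cf m j * cf n i) • (Y[[m - j]]) ((X[[n - i]]) ((A[[p + j + i]]) v)) =
      (cf n i * cf m j) • ((Z[[n + m - (i + j : ℕ)]]) ((A[[p + (i + j : ℕ)]]) v) +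
        if n + m = (i + j : ℕ) then (((n : ℂ) - i) * κ) • (A[[p + (i + j : ℕ)]]) v else 0) :=
    fun i j => by
      have e1 : p + (j : ℤ) + i = p + (i + j : ℕ) := by push_cast; ring
      have e2 : p + (i : ℤ) + j = p + (i + j : ℕ) := by push_cast; ring
      have e3 : n - (i : ℤ) + (m - j) = n + m - (i + j : ℕ) := by push_cast; ring
      rw [e1, e2, mul_comm (cf m j), ← smul_sub, h, e3]
      simp only [sub_eq_zero]
      push_cast
      rfl
  simp only [step]
  rw [sum_square_eq (fun i j : ℕ => (cf n i * cf m j) •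
      ((Z[[n + m - (i + j : ℕ)]]) ((A[[p + (i + j : ℕ)]]) v) +
        if n + m = (i + j : ℕ) then (((n : ℂ) - i) * κ) • (A[[p + (i + j : ℕ)]]) v else 0)) N
      fun i j hij => by rw [hN _ hij]; simp]
  rw [ncoeff_add, hc, leftProd_apply _ _ _ _ _ hN]
  have inner : ∀ l : ℕ, ∑ q ∈ Finset.HasAntidiagonal.antidiagonal l, (cf n q.1 * cf m q.2) •
      ((Z[[n + m - (q.1 + q.2 : ℕ)]]) ((A[[p + (q.1 + q.2 : ℕ)]]) v) +
        if n + m = (q.1 + q.2 : ℕ) then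
          (((n : ℂ) - q.1) * κ) • (A[[p + (q.1 + q.2 : ℕ)]]) v else 0) =
      cf (n + m) l • (Z[[n + m - l]]) ((A[[p + l]]) v) +
        if (l : ℤ) = n + m then
          if n + m = 0 then ((n : ℂ) * κ) • (A[[p]]) v else 0 else 0 := fun l => by
    have : ∀ q ∈ Finset.HasAntidiagonal.antidiagonal l, (cf n q.1 * cf m q.2) •
      ((Z[[n + m - (q.1 + q.2 : ℕ)]]) ((A[[p + (q.1 + q.2 : ℕ)]]) v) +
        if n + m = (q.1 + q.2 : ℕ) then
          (((n : ℂ) - q.1) * κ) • (A[[p + (q.1 + q.2 : ℕ)]]) v else 0) =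
        (cf n q.1 * cf m q.2) • (Z[[n + m - l]]) ((A[[p + l]]) v) +
        (cf n q.1 * cf m q.2 * ((n : ℂ) - q.1)) •
          if n + m = l then κ • (A[[p + l]]) v else 0 := fun q hq => by
      rw [Finset.HasAntidiagonal.mem_antidiagonal.1 hq, smul_add]
      congr 1
      split_ifs
      · simp only [smul_smul]; congr 1; ring
      · simp
    rw [Finset.sum_congr rfl this, Finset.sum_add_distrib, ← Finset.sum_smul, ← Finset.sum_smul,
      cf_conv]
    congr 1
    by_cases hl : n + m = l
    · rw [cf_central n m l hl, if_pos hl, if_pos hl.symm]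
      split_ifs with h2
      · have : l = 0 := by omega
        subst this
        simp [smul_smul]
      · simp
    · rw [if_neg hl, if_neg (Ne.symm hl), smul_zero]
  simp only [inner, Finset.sum_add_distrib]
  congr 1
  by_cases h2 : n + m = 0
  · simp only [h2, if_true]
    by_cases hN0 : N = 0
    · have := hN 0 (by omega)
      simp only [Nat.cast_zero, add_zero] at this
      simp [this]
    · rw [Finset.sum_eq_single 0]
      · simp
      · intro l _ hl; simp [hl]
      · intro hl; simp at hl; exact absurd hl hN0
  · simp [h2]

theorem right_right {X Y Z : VertexOperator ℂ V} {κ : ℂ} (h : CurrentOPE X Y Z κ) (n m : ℤ)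
    (A : VertexOperator ℂ V) :
    rightProd X n (rightProd Y m A) - rightProd Y m (rightProd X n A) =
      - rightProd Z (n + m) A := by
  refine field_ext fun p v => ?_
  have trunc2 : ∀ X Y : VertexOperator ℂ V, ∃ N : ℕ, ∀ i j : ℕ, N ≤ i + j →
      (Y[[(j : ℤ)]]) ((X[[(i : ℤ)]]) v) = 0 := fun X Y => by
    obtain ⟨M, hM⟩ := trunc0 X v
    choose N hN using fun i : ℕ => trunc0 Y ((X[[(i : ℤ)]]) v)
    obtain ⟨P, hP⟩ := ((Finset.range M).image N).exists_le
    refine ⟨M + P, fun i j hij => ?_⟩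
    by_cases hi : i < M
    · have := hP (N i) (Finset.mem_image_of_mem _ (Finset.mem_range.2 hi))
      exact hN i j (by omega)
    · rw [hM i (by omega), map_zero]
  obtain ⟨N1, hN1⟩ := trunc2 X Y
  obtain ⟨N2, hN2⟩ := trunc2 Y X
  obtain ⟨N3, hN3⟩ := trunc0 X v
  obtain ⟨N4, hN4⟩ := trunc0 Y v
  obtain ⟨N5, hN5⟩ := trunc0 Z v
  set N := N1 + N2 + N3 + N4 + N5 with hNdef
  have key : ∀ (X Y : VertexOperator ℂ V) (n m : ℤ),
      (∀ i : ℕ, i ≥ N → (X[[(i : ℤ)]]) v = 0) →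
      (∀ i j : ℕ, N ≤ i + j → (Y[[(j : ℤ)]]) ((X[[(i : ℤ)]]) v) = 0) →
      ((rightProd X n (rightProd Y m A))[[p]]) v =
      ∑ i ∈ Finset.range N, ∑ j ∈ Finset.range N, ((-1) ^ (n + m) * (cf n i * cf m j)) •
        (A[[n + m + p - (i + j : ℕ)]]) ((Y[[(j : ℤ)]]) ((X[[(i : ℤ)]]) v)) :=
    fun X Y n m hX hXY => by
      rw [rightProd_apply _ _ _ _ _ hX]
      refine Finset.sum_congr rfl fun i _ => ?_
      rw [rightProd_apply _ _ _ _ _ (N := N) fun j hj => hXY i j (by omega), Finset.smul_sum]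
      refine Finset.sum_congr rfl fun j _ => ?_
      have e1 : m + (n + p - (i : ℤ)) - (j : ℤ) = n + m + p - (i + j : ℕ) := by push_cast; ring
      have e2 : ((-1 : ℂ) ^ n * cf n i) * ((-1) ^ m * cf m j) =
          (-1) ^ (n + m) * (cf n i * cf m j) := by
        rw [zpow_add₀ (by norm_num)]; ring
      rw [smul_smul, e1, e2]
  rw [ncoeff_sub, key X Y n m (fun i hi => hN3 i (by omega)) (fun i j hij => hN1 i j (by omega)),
    key Y X m n (fun i hi => hN4 i (by omega)) (fun i j hij => hN2 i j (by omega)),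
    Finset.sum_comm (f := fun i j : ℕ => ((-1) ^ (m + n) * (cf m i * cf n j)) •
        (A[[m + n + p - (i + j : ℕ)]]) ((X[[(j : ℤ)]]) ((Y[[(i : ℤ)]]) v))),
    ← Finset.sum_sub_distrib]
  simp only [← Finset.sum_sub_distrib]
  have step : ∀ i j : ℕ, ((-1) ^ (n + m) * (cf n i * cf m j)) •
        (A[[n + m + p - (i + j : ℕ)]]) ((Y[[(j : ℤ)]]) ((X[[(i : ℤ)]]) v)) -
      ((-1) ^ (m + n) * (cf m j * cf n i)) •
        (A[[m + n + p - (j + i : ℕ)]]) ((X[[(i : ℤ)]]) ((Y[[(j : ℤ)]]) v)) =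
      -(((-1) ^ (n + m) * (cf n i * cf m j)) •
        (A[[n + m + p - (i + j : ℕ)]]) ((Z[[((i + j : ℕ) : ℤ)]]) v)) := fun i j => by
    have hz : (if (i : ℤ) + j = 0 then (((i : ℤ) : ℂ) * κ) • v else 0) = 0 := by
      split_ifs with h0
      · have : i = 0 := by omega
        simp [this]
      · rfl
    have h1 := h i j v
    rw [hz, add_zero] at h1
    rw [Nat.cast_add i j, ← h1, add_comm m n, mul_comm (cf m j), Nat.cast_add j i,
      add_comm (j : ℤ) i, map_sub, ← smul_sub, ← smul_neg, neg_sub]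
  simp only [step, Finset.sum_neg_distrib]
  have hneg : ((-rightProd Z (n + m) A)[[p]]) v = -((rightProd Z (n + m) A)[[p]]) v := by
    rw [map_neg]; rfl
  rw [hneg, sum_square_eq (fun i j : ℕ => ((-1) ^ (n + m) * (cf n i * cf m j)) •
        (A[[n + m + p - (i + j : ℕ)]]) ((Z[[((i + j : ℕ) : ℤ)]]) v)) N
      fun i j hij => by rw [hN5 _ (by omega), map_zero, smul_zero],
    rightProd_apply _ _ _ _ _ (N := N) fun j hj => hN5 j (by omega)]
  congr 1
  refine Finset.sum_congr rfl fun l _ => ?_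
  rw [← cf_conv, Finset.mul_sum, Finset.sum_smul]
  refine Finset.sum_congr rfl fun q hq => ?_
  rw [Finset.HasAntidiagonal.mem_antidiagonal.1 hq]

/-- If two fields satisfy the commutation relations of currents, so do the operators of taking
`n`-th products with them, on the space of all fields. -/
theorem nthProd_comm {X Y Z : VertexOperator ℂ V} {κ : ℂ} (h : CurrentOPE X Y Z κ) (n m : ℤ)
    (A : VertexOperator ℂ V) :
    nthProd n X (nthProd m Y A) - nthProd m Y (nthProd n X A) =
      nthProd (n + m) Z A + if n + m = 0 then ((n : ℂ) * κ) • A else 0 := by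
  have e1 : nthProd n X (nthProd m Y A) =
      (leftProd X n (leftProd Y m A) - rightProd Y m (leftProd X n A)) -
        (rightProd X n (leftProd Y m A) - rightProd X n (rightProd Y m A)) := by
    rw [← left_right_comm]
    change leftProdL (V := V) n X (leftProdL (V := V) m Y A - rightProdL (V := V) m Y A) -
      rightProdL (V := V) n X (leftProdL (V := V) m Y A - rightProdL (V := V) m Y A) = _
    rw [map_sub, map_sub]; rfl
  have e2 : nthProd m Y (nthProd n X A) =
      (leftProd Y m (leftProd X n A) - rightProd X n (leftProd Y m A)) -
        (rightProd Y m (leftProd X n A) - rightProd Y m (rightProd X n A)) := by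
    rw [← left_right_comm Y X]
    change leftProdL (V := V) m Y (leftProdL (V := V) n X A - rightProdL (V := V) n X A) -
      rightProdL (V := V) m Y (leftProdL (V := V) n X A - rightProdL (V := V) n X A) = _
    rw [map_sub, map_sub]; rfl
  rw [e1, e2, nthProd_eq]
  have h1 := left_left h n m A
  have h2 := right_right h n m A
  rw [sub_eq_iff_eq_add] at h1 h2
  rw [h1, h2]
  abel

/-- The identity field `I_V`. -/
def idField : VertexOperator ℂ V :=
  fieldOfModes (fun n => if n = -1 then 1 else 0) fun v =>
    ⟨0, fun n hn => by rw [if_neg (by omega)]; rfl⟩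

theorem ncoeff_idField (n : ℤ) (v : V) :
    ((idField : VertexOperator ℂ V)[[n]]) v = if n = -1 then v else 0 := by
  rw [idField, ncoeff_fieldOfModes]
  split_ifs <;> rfl

theorem leftProd_idField (X : VertexOperator ℂ V) (n m : ℤ) (v : V) :
    ((leftProd X n idField)[[m]]) v =
      if m < 0 then cf n (-1 - m).toNat • (X[[n + m + 1]]) v else 0 := by
  rw [leftProd_apply _ _ _ _ _ (N := (-m).toNat) fun j hj => by
    rw [ncoeff_idField, if_neg (by omega)] ]
  simp only [ncoeff_idField]
  split_ifs with h
  · rw [Finset.sum_eq_single (-1 - m).toNat]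
    · rw [if_pos (by omega), show n - ((-1 - m).toNat : ℤ) = n + m + 1 by omega]
    · intro j _ hj
      rw [if_neg (by omega), map_zero, smul_zero]
    · intro hj
      simp only [Finset.mem_range] at hj
      omega
  · refine Finset.sum_eq_zero fun j _ => ?_
    rw [if_neg (by omega), map_zero, smul_zero]

theorem rightProd_idField (X : VertexOperator ℂ V) (n m : ℤ) (v : V) :
    ((rightProd X n idField)[[m]]) v =
      if 0 ≤ n + m + 1 then
        ((-1) ^ n * cf n (n + m + 1).toNat) • (X[[n + m + 1]]) v else 0 := by
  obtain ⟨N, hN⟩ := trunc0 X v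
  rw [rightProd_apply _ _ _ _ _ (N := N + (n + m + 2).toNat) fun j hj => hN j (by omega)]
  simp only [ncoeff_idField]
  split_ifs with h
  · rw [Finset.sum_eq_single (n + m + 1).toNat]
    · rw [if_pos (by omega), show ((n + m + 1).toNat : ℤ) = n + m + 1 by omega]
    · intro j _ hj
      rw [if_neg (by omega), smul_zero]
    · intro hj
      simp only [Finset.mem_range] at hj
      omega
  · refine Finset.sum_eq_zero fun j _ => ?_
    rw [if_neg (by omega), smul_zero]

theorem nthProd_idField (X : VertexOperator ℂ V) (n : ℕ) : nthProd n X idField = 0 := by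
  refine field_ext fun m v => ?_
  rw [nthProd_eq, ncoeff_sub, leftProd_idField, rightProd_idField, map_zero]
  change _ = (0 : V)
  have hc : ∀ j : ℕ, cf n j = (-1) ^ j * (n.choose j : ℂ) := fun j => by
    rw [cf, Ring.choose_natCast]; simp
  rw [sub_eq_zero]
  split_ifs with h1 h2 h2
  · congr 1
    rw [hc, hc]
    have e : (n + m + 1 : ℤ).toNat = n - (-1 - m).toNat := by omega
    have hle : (-1 - m).toNat ≤ n := by omega
    rw [e, Nat.choose_symm hle, zpow_natCast, ← mul_assoc, ← pow_add]
    congr 1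
    obtain ⟨d, hd⟩ := Nat.exists_eq_add_of_le hle
    rw [hd, Nat.add_sub_cancel_left, show (-1 - m).toNat + d + d = (-1 - m).toNat + 2 * d by ring,
      pow_add, pow_mul]
    simp
  · rw [hc, Nat.choose_eq_zero_of_lt (by omega)]; simp
  · rw [hc, Nat.choose_eq_zero_of_lt (by omega)]; simp
  · rfl

theorem nthProd_neg_one_idField (X : VertexOperator ℂ V) : nthProd (-1) X idField = X := by
  refine field_ext fun m v => ?_
  rw [nthProd_eq, ncoeff_sub, leftProd_idField, rightProd_idField]
  have hc : ∀ j : ℕ, cf (-1) j = 1 := fun j => by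
    rw [cf, Ring.choose_neg, add_sub_cancel_left, Ring.choose_natCast, Nat.choose_self,
      Int.negOnePow_def]
    simp [Units.smul_def, ← mul_pow]
  rw [hc, hc, show -1 + m + 1 = m by ring]
  by_cases h : m < 0
  · rw [if_pos h, if_neg (by omega), one_smul, sub_zero]
  · rw [if_neg h, if_pos (by omega)]; simp

end

/-! ### The affine Lie algebra, the space `V^k(𝔤)` and its state-field correspondence -/

section

attribute [local instance] LieRing.ofAssociativeRing

/-- An invariant symmetric bilinear form on a complex Lie algebra. -/
structure InvariantForm (𝔤 : Type*) [LieRing 𝔤] [LieAlgebra ℂ 𝔤] where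
  form : LinearMap.BilinForm ℂ 𝔤
  invariant : form.lieInvariant 𝔤
  symm : form.IsSymm

section
variable {𝔤 : Type*} [LieRing 𝔤] [LieAlgebra ℂ 𝔤] (B : InvariantForm 𝔤)

/-- The cocycle `(x t^m, y t^n) ↦ m (x, y) δ_{m,-n}`; Mathlib's cocycle is `n (x, y) δ_{m,-n}`,
whence the sign. -/
def affineCocycle : LieModule.Cohomology.twoCocycle ℂ (LieAlgebra.loopAlgebra ℂ ℤ 𝔤)
    (TrivialLieModule ℂ (LieAlgebra.loopAlgebra ℂ ℤ 𝔤) ℂ) :=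
  LieAlgebra.LoopAlgebra.twoCocycleOfBilinear ℂ ℤ 𝔤 (-B.form)
    (fun x y z => by simp [B.invariant x y z]) ⟨fun x y => by simpa using B.symm.eq x y⟩

/-- The affine Kac-Moody Lie algebra `𝔤[t, t⁻¹] ⊕ ℂ K`. -/
def AffineLie := LieAlgebra.ofTwoCocycle (affineCocycle B)

instance : LieRing (AffineLie B) := inferInstanceAs (LieRing (LieAlgebra.ofTwoCocycle _))

instance : LieAlgebra ℂ (AffineLie B) :=
  inferInstanceAs (LieAlgebra ℂ (LieAlgebra.ofTwoCocycle (affineCocycle B)))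

/-- The underlying vector space of `𝔤̂`. -/
def affineEquiv : AffineLie B ≃ₗ[ℂ] LieAlgebra.loopAlgebra ℂ ℤ 𝔤 × ℂ where
  toFun u := (((LieAlgebra.ofProd (affineCocycle B)).symm u).1,
    TrivialLieModule.equiv ℂ _ ℂ ((LieAlgebra.ofProd (affineCocycle B)).symm u).2)
  invFun p := LieAlgebra.ofProd (affineCocycle B) (p.1, (TrivialLieModule.equiv ℂ _ ℂ).symm p.2)
  map_add' _ _ := rfl
  map_smul' _ _ := rfl
  left_inv _ := rfl
  right_inv _ := rfl

/-- The element `x t^n`. -/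
def cur (n : ℤ) : 𝔤 →ₗ[ℂ] AffineLie B :=
  (affineEquiv B).symm.toLinearMap ∘ₗ LinearMap.inl ℂ _ ℂ ∘ₗ
    TensorProduct.mk ℂ (AddMonoidAlgebra ℂ ℤ) 𝔤 (AddMonoidAlgebra.single n 1)

/-- The central element `K`. -/
def central : AffineLie B := (affineEquiv B).symm (0, 1)

theorem affineEquiv_cur (n : ℤ) (x : 𝔤) :
    affineEquiv B (cur B n x) = (AddMonoidAlgebra.single n 1 ⊗ₜ x, 0) := rfl

theorem affineEquiv_central : affineEquiv B (central B) = (0, 1) := rfl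

theorem affineEquiv_lie (u v : AffineLie B) : affineEquiv B ⁅u, v⁆ =
    (⁅(affineEquiv B u).1, (affineEquiv B v).1⁆,
      LieAlgebra.LoopAlgebra.residuePairing ℂ ℤ 𝔤 (-B.form)
        (affineEquiv B u).1 (affineEquiv B v).1) := by
  change affineEquiv B (LieAlgebra.ofProd (affineCocycle B) (_, _)) = _
  refine Prod.ext rfl ?_
  change TrivialLieModule.equiv ℂ _ ℂ (_ + _ - _) = _
  rw [LieModule.IsTrivial.trivial, LieModule.IsTrivial.trivial, add_zero, sub_zero]
  rfl

theorem central_lie (u : AffineLie B) : ⁅central B, u⁆ = 0 := by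
  apply (affineEquiv B).injective
  rw [affineEquiv_lie, affineEquiv_central, map_zero (affineEquiv B)]
  have h : ∀ l : LieAlgebra.loopAlgebra ℂ ℤ 𝔤, ⁅(0 : LieAlgebra.loopAlgebra ℂ ℤ 𝔤), l⁆ = 0 :=
    fun l => zero_lie (L := LieAlgebra.loopAlgebra ℂ ℤ 𝔤) l
  dsimp only
  rw [h, map_zero]
  rfl

theorem cur_lie_cur (m n : ℤ) (x y : 𝔤) :
    ⁅cur B m x, cur B n y⁆ =
      cur B (m + n) ⁅x, y⁆ + if m + n = 0 then ((m : ℂ) * B.form x y) • central B else 0 := by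
  apply (affineEquiv B).injective
  have h : affineEquiv B (if m + n = 0 then ((m : ℂ) * B.form x y) • central B else 0) =
      (0, if m + n = 0 then (m : ℂ) * B.form x y else 0) := by
    split_ifs
    · rw [map_smul, affineEquiv_central, Prod.smul_mk, smul_zero, smul_eq_mul, mul_one]
    · rw [map_zero]; rfl
  rw [map_add, h, affineEquiv_lie, affineEquiv_cur, affineEquiv_cur, affineEquiv_cur]
  refine Prod.ext ?_ ?_
  · rw [Prod.fst_add, add_zero, LieAlgebra.ExtendScalars.bracket_tmul,
      AddMonoidAlgebra.single_mul_single, one_mul]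
  · rw [Prod.snd_add, zero_add, LieAlgebra.LoopAlgebra.residuePairing_apply_apply,
      LieAlgebra.LoopAlgebra.toFinsupp_single_tmul, LieAlgebra.LoopAlgebra.toFinsupp_single_tmul,
      Finsupp.sum_single_index (by simp), Finsupp.single_apply]
    by_cases hmn : m + n = 0
    · rw [if_pos hmn, if_pos (by omega), show n = -m by omega]
      simp
    · rw [if_neg hmn, if_neg (by omega)]
      simp

theorem affine_span (W : Submodule ℂ (AffineLie B)) (hc : ∀ n x, cur B n x ∈ W)
    (hK : central B ∈ W) (u : AffineLie B) : u ∈ W := by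
  have h1 : ∀ l, (affineEquiv B).symm (l, 0) ∈ W := fun l => by
    induction l using TensorProduct.induction_on with
    | zero => rw [← Prod.zero_eq_mk, map_zero]; exact W.zero_mem
    | add a b ha hb =>
      have := W.add_mem ha hb
      rwa [← map_add, Prod.mk_add_mk, add_zero] at this
    | tmul p x =>
      induction p using AddMonoidAlgebra.induction_linear with
      | zero => rw [TensorProduct.zero_tmul, ← Prod.zero_eq_mk, map_zero]; exact W.zero_mem
      | add a b ha hb =>
        have := W.add_mem ha hb
        rwa [← map_add, Prod.mk_add_mk, add_zero, ← TensorProduct.add_tmul] at this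
      | single n c =>
        have := W.smul_mem c (hc n x)
        rw [← map_smul] at this
        convert this using 1
        apply (affineEquiv B).injective
        rw [LinearEquiv.apply_symm_apply, affineEquiv_cur, TensorProduct.tmul_smul,
          TensorProduct.smul_tmul', AddMonoidAlgebra.smul_single, smul_eq_mul, mul_one]
  have h2 := W.add_mem (h1 (affineEquiv B u).1) (W.smul_mem (affineEquiv B u).2 hK)
  convert h2 using 1
  apply (affineEquiv B).injective
  rw [map_add, LinearEquiv.apply_symm_apply, map_smul, affineEquiv_central]
  simp

/-- The enveloping algebra of the affine Lie algebra. -/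
abbrev AffineU := UniversalEnvelopingAlgebra ℂ (AffineLie B)

/-- The left ideal of `U(𝔤̂)` generated by `𝔤[t]` and `K - k`. -/
def vacuumIdeal (k : ℂ) : Submodule (AffineU B) (AffineU B) :=
  Submodule.span _ ({u | ∃ (n : ℕ) (x : 𝔤), u = UniversalEnvelopingAlgebra.ι ℂ (cur B n x)} ∪
    {UniversalEnvelopingAlgebra.ι ℂ (central B) - algebraMap ℂ _ k})

/-- `V^k(𝔤) = U(𝔤̂) ⊗_{U(𝔤[t] ⊕ ℂK)} ℂ_k`, as the quotient of `U(𝔤̂)` by the left ideal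
generated by `𝔤[t]` and `K - k`. -/
def Vac (k : ℂ) := AffineU B ⧸ vacuumIdeal B k

instance (k : ℂ) : AddCommGroup (Vac B k) :=
  inferInstanceAs (AddCommGroup (AffineU B ⧸ vacuumIdeal B k))

instance (k : ℂ) : Module (AffineU B) (Vac B k) :=
  inferInstanceAs (Module (AffineU B) (AffineU B ⧸ vacuumIdeal B k))

instance (k : ℂ) : Module ℂ (Vac B k) :=
  inferInstanceAs (Module ℂ (AffineU B ⧸ vacuumIdeal B k))

instance (k : ℂ) : IsScalarTower ℂ (AffineU B) (Vac B k) :=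
  inferInstanceAs (IsScalarTower ℂ (AffineU B) (AffineU B ⧸ vacuumIdeal B k))

/-- The projection `U(𝔤̂) → V^k(𝔤)`, `u ↦ u ⊗ 1`. -/
def toVac (k : ℂ) : AffineU B →ₗ[AffineU B] Vac B k := (vacuumIdeal B k).mkQ

theorem toVac_surjective (k : ℂ) : Function.Surjective (toVac B k) :=
  (vacuumIdeal B k).mkQ_surjective

theorem toVac_eq_zero {k : ℂ} {u : AffineU B} : toVac B k u = 0 ↔ u ∈ vacuumIdeal B k :=
  Submodule.Quotient.mk_eq_zero _

variable (k : ℂ)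

/-- The vacuum vector `1 ⊗ 1`. -/
def vac : Vac B k := toVac B k 1

/-- The action of `u ∈ 𝔤̂` on `V^k(𝔤)`. -/
def act : AffineLie B →ₗ[ℂ] Module.End ℂ (Vac B k) :=
  (Algebra.lsmul ℂ ℂ (Vac B k)).toLinearMap ∘ₗ (UniversalEnvelopingAlgebra.ι ℂ).toLinearMap

theorem act_apply (u : AffineLie B) (v : Vac B k) :
    act B k u v = UniversalEnvelopingAlgebra.ι ℂ u • v := rfl

theorem act_lie (u w : AffineLie B) (v : Vac B k) :
    act B k u (act B k w v) - act B k w (act B k u v) = act B k ⁅u, w⁆ v := by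
  simp only [act_apply, LieHom.map_lie, LieRing.of_associative_ring_bracket, sub_smul, mul_smul]

theorem Vac_span (W : Submodule ℂ (Vac B k)) (h0 : vac B k ∈ W)
    (h : ∀ u, ∀ v ∈ W, act B k u v ∈ W) (v : Vac B k) : v ∈ W := by
  let S : Subalgebra ℂ (AffineU B) :=
    { carrier := {u | ∀ v ∈ W, u • v ∈ W}
      mul_mem' := fun {a b} ha hb v hv => by rw [mul_smul]; exact ha _ (hb v hv)
      add_mem' := fun {a b} ha hb v hv => by rw [add_smul]; exact W.add_mem (ha v hv) (hb v hv)
      algebraMap_mem' := fun c v hv => by rw [algebraMap_smul]; exact W.smul_mem c hv }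
  let f : AffineLie B →ₗ⁅ℂ⁆ S :=
    { toFun := fun u => ⟨UniversalEnvelopingAlgebra.ι ℂ u, h u⟩
      map_add' := fun a b => by ext; simp
      map_smul' := fun a b => by ext; simp
      map_lie' := fun {a b} => by
        ext
        simp [LieRing.of_associative_ring_bracket] }
  have key : S.val.comp (UniversalEnvelopingAlgebra.lift ℂ f) = AlgHom.id ℂ _ := by
    apply UniversalEnvelopingAlgebra.hom_ext
    ext u
    simp [f]
  obtain ⟨u, rfl⟩ := toVac_surjective B k v
  have hu : u ∈ S := by
    have := DFunLike.congr_fun key u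
    rw [AlgHom.id_apply] at this
    rw [← this]
    exact (UniversalEnvelopingAlgebra.lift ℂ f u).2
  have := hu _ h0
  rwa [vac, ← map_smul, smul_eq_mul, mul_one] at this

theorem act_vac (n : ℕ) (x : 𝔤) : act B k (cur B n x) (vac B k) = 0 := by
  rw [act_apply, vac, ← map_smul, smul_eq_mul, mul_one, toVac_eq_zero]
  exact Submodule.subset_span (Or.inl ⟨n, x, rfl⟩)

theorem act_central (v : Vac B k) : act B k (central B) v = k • v := by
  have := Vac_span B k (LinearMap.eqLocus (act B k (central B)) (k • LinearMap.id)) ?_ ?_ v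
  · simpa using this
  · rw [LinearMap.mem_eqLocus, act_apply, LinearMap.smul_apply, LinearMap.id_apply, ← sub_eq_zero,
      ← algebraMap_smul (AffineU B) k, ← sub_smul, vac, ← map_smul, smul_eq_mul,
      mul_one, toVac_eq_zero]
    exact Submodule.subset_span (Or.inr rfl)
  · intro u v hv
    rw [LinearMap.mem_eqLocus, LinearMap.smul_apply, LinearMap.id_apply] at *
    have h1 := act_lie B k (central B) u v
    rw [central_lie, map_zero, LinearMap.zero_apply, sub_eq_zero] at h1
    rw [h1, hv, map_smul]

theorem act_smooth (v : Vac B k) : ∀ x : 𝔤, ∃ N : ℤ, ∀ n ≥ N, act B k (cur B n x) v = 0 := by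
  let W : Submodule ℂ (Vac B k) :=
    { carrier := {v | ∀ x : 𝔤, ∃ N : ℤ, ∀ n ≥ N, act B k (cur B n x) v = 0}
      zero_mem' := fun x => ⟨0, fun n _ => map_zero _⟩
      add_mem' := fun {a b} ha hb x => by
        obtain ⟨N, hN⟩ := ha x
        obtain ⟨M, hM⟩ := hb x
        exact ⟨max N M, fun n hn => by rw [map_add, hN n (by omega), hM n (by omega), add_zero]⟩
      smul_mem' := fun c a ha x => by
        obtain ⟨N, hN⟩ := ha x
        exact ⟨N, fun n hn => by rw [map_smul, hN n hn, smul_zero]⟩ }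
  refine Vac_span B k W (fun x => ⟨0, fun n hn => ?_⟩) (fun u v hv => ?_) v
  · lift n to ℕ using hn
    exact act_vac B k n x
  · let W' : Submodule ℂ (AffineLie B) := W.comap ((act B k).flip v)
    refine affine_span B W' (fun m y => fun x => ?_) ?_ u
    · obtain ⟨N, hN⟩ := hv x
      obtain ⟨M, hM⟩ := hv ⁅x, y⁆
      refine ⟨max (max N (M - m)) (1 - m), fun n hn => ?_⟩
      have h1 := act_lie B k (cur B n x) (cur B m y) v
      rw [hN n (by omega), map_zero, sub_zero, cur_lie_cur, if_neg (by omega), add_zero,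
        hM _ (by omega)] at h1
      exact h1
    · change act B k (central B) v ∈ W
      rw [act_central]
      exact W.smul_mem k hv

/-- The current `x(z) = ∑ (x t^n) z^{-n-1}`, a field on `V^k(𝔤)`. -/
def current : 𝔤 →ₗ[ℂ] VertexOperator ℂ (Vac B k) where
  toFun x := fieldOfModes (fun n => act B k (cur B n x)) fun v => act_smooth B k v x
  map_add' x y := field_ext fun n v => by simp
  map_smul' c x := field_ext fun n v => by simp

theorem ncoeff_current (n : ℤ) (x : 𝔤) : (current B k x)[[n]] = act B k (cur B n x) := by
  simp [current]

theorem current_ope (x y : 𝔤) :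
    CurrentOPE (current B k x) (current B k y) (current B k ⁅x, y⁆) (k * B.form x y) := by
  intro a b v
  simp only [ncoeff_current, act_lie, cur_lie_cur, map_add, LinearMap.add_apply]
  congr 1
  split_ifs
  · rw [map_smul, LinearMap.smul_apply, act_central, smul_smul]; congr 1; ring
  · simp

/-- The action of `𝔤̂` on the space of all fields on `V^k(𝔤)`: `x t^n` acts by the `n`-th product
with `x(z)` and `K` acts by `k`. -/
def fieldActL : AffineLie B →ₗ[ℂ] Module.End ℂ (VertexOperator ℂ (Vac B k)) :=
  (LinearMap.coprod
    (Finsupp.lsum ℂ (fun n => nthProd (V := Vac B k) n ∘ₗ current B k) ∘ₗ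
      (LieAlgebra.LoopAlgebra.toFinsupp ℂ ℤ 𝔤).toLinearMap)
    (LinearMap.toSpanSingleton ℂ _ (k • LinearMap.id))) ∘ₗ (affineEquiv B).toLinearMap

theorem fieldActL_cur (n : ℤ) (x : 𝔤) : fieldActL B k (cur B n x) = nthProd n (current B k x) := by
  simp only [fieldActL, LinearMap.comp_apply, LinearEquiv.coe_coe, affineEquiv_cur,
    LinearMap.coprod_apply, map_zero, add_zero]
  rw [LieAlgebra.LoopAlgebra.toFinsupp_single_tmul, Finsupp.lsum_single]
  rfl

theorem fieldActL_central : fieldActL B k (central B) = k • LinearMap.id := by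
  simp only [fieldActL, LinearMap.comp_apply, LinearEquiv.coe_coe, affineEquiv_central,
    LinearMap.coprod_apply, map_zero, zero_add, LinearMap.toSpanSingleton_apply, one_smul]

theorem fieldActL_lie (u v : AffineLie B) (A : VertexOperator ℂ (Vac B k)) :
    fieldActL B k ⁅u, v⁆ A =
      fieldActL B k u (fieldActL B k v A) - fieldActL B k v (fieldActL B k u A) := by
  let W (v : AffineLie B) : Submodule ℂ (AffineLie B) :=
    { carrier := {u | ∀ A, fieldActL B k ⁅u, v⁆ A =
        fieldActL B k u (fieldActL B k v A) - fieldActL B k v (fieldActL B k u A)}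
      zero_mem' := fun A => by simp
      add_mem' := fun {a b} ha hb A => by
        rw [add_lie, map_add, LinearMap.add_apply, ha, hb, map_add, LinearMap.add_apply,
          LinearMap.add_apply, map_add]
        abel
      smul_mem' := fun c a ha A => by
        rw [smul_lie, map_smul, LinearMap.smul_apply, ha, map_smul, LinearMap.smul_apply,
          LinearMap.smul_apply, map_smul, smul_sub] }
  have hskew : ∀ u v, u ∈ W v → v ∈ W u := fun u v h A => by
    rw [← lie_skew, map_neg, LinearMap.neg_apply, h A, neg_sub]
  have hK : ∀ v, central B ∈ W v := fun v A => by
    rw [central_lie, map_zero, LinearMap.zero_apply, fieldActL_central]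
    simp
  refine affine_span B (W v) (fun m x => hskew _ _ ?_) (hK v) u A
  refine affine_span B (W (cur B m x)) (fun n y => ?_) (hK _) v
  intro A
  rw [cur_lie_cur, map_add, LinearMap.add_apply, fieldActL_cur, fieldActL_cur, fieldActL_cur,
    nthProd_comm (current_ope B k y x)]
  congr 1
  split_ifs
  · rw [map_smul, LinearMap.smul_apply, fieldActL_central, LinearMap.smul_apply, LinearMap.id_apply,
      smul_smul]
    congr 1
    ring
  · rw [map_zero, LinearMap.zero_apply]

/-- `fieldActL` as a representation of `𝔤̂`. -/
def fieldAct : AffineLie B →ₗ⁅ℂ⁆ Module.End ℂ (VertexOperator ℂ (Vac B k)) :=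
  { fieldActL B k with map_lie' := fun {u v} => LinearMap.ext fun A => fieldActL_lie B k u v A }

/-- The resulting action of `U(𝔤̂)`. -/
def fieldActU : AffineU B →ₐ[ℂ] Module.End ℂ (VertexOperator ℂ (Vac B k)) :=
  UniversalEnvelopingAlgebra.lift ℂ (fieldAct B k)

theorem fieldActU_ι (u : AffineLie B) :
    fieldActU B k (UniversalEnvelopingAlgebra.ι ℂ u) = fieldActL B k u :=
  UniversalEnvelopingAlgebra.lift_ι_apply ℂ (fieldAct B k) u

theorem vacuumIdeal_le : (vacuumIdeal B k).restrictScalars ℂ ≤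
    LinearMap.ker ((fieldActU B k).toLinearMap.flip idField) := by
  intro u hu
  change fieldActU B k u idField = 0
  refine Submodule.span_induction (p := fun u _ => fieldActU B k u idField = 0) ?_ ?_ ?_ ?_ hu
  · rintro _ (⟨n, x, rfl⟩ | rfl)
    · rw [fieldActU_ι, fieldActL_cur, nthProd_idField]
    · rw [map_sub, fieldActU_ι, fieldActL_central, AlgHom.commutes, LinearMap.sub_apply, sub_eq_zero]
      rfl
  · rw [map_zero, LinearMap.zero_apply]
  · intro a b _ _ ha hb
    rw [map_add, LinearMap.add_apply, ha, hb, add_zero]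
  · intro a b _ hb
    rw [smul_eq_mul, map_mul, Module.End.mul_apply, hb, map_zero]

/-- The state-field correspondence `Y : V^k(𝔤) → Hom(V^k(𝔤), V^k(𝔤)((z)))`: the unique
`𝔤̂`-equivariant map with `Y(|0⟩, z) = I`, where `x t^n` acts on fields by the `n`-th product with
`x(z)`. On monomials it is
`Y((x₁ t^(-n₁-1)) ⋯ (x_r t^(-n_r-1))|0⟩, z) = :∂^(n₁) x₁(z) ⋯ ∂^(n_r) x_r(z):`. -/
def stateField : Vac B k →ₗ[ℂ] VertexOperator ℂ (Vac B k) :=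
  ((vacuumIdeal B k).restrictScalars ℂ).liftQ ((fieldActU B k).toLinearMap.flip idField)
      (vacuumIdeal_le B k) ∘ₗ
    (Submodule.Quotient.restrictScalarsEquiv ℂ (vacuumIdeal B k)).symm.toLinearMap

theorem stateField_toVac (u : AffineU B) :
    stateField B k (toVac B k u) = fieldActU B k u idField := rfl

theorem stateField_vac : stateField B k (vac B k) = idField := by
  rw [vac, stateField_toVac, map_one]; rfl

/-- `Y((x t^n) v, z) = x(z)_(n) Y(v, z)`. -/
theorem stateField_act (n : ℤ) (x : 𝔤) (v : Vac B k) :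
    stateField B k (act B k (cur B n x) v) = nthProd n (current B k x) (stateField B k v) := by
  obtain ⟨u, rfl⟩ := toVac_surjective B k v
  rw [act_apply, ← map_smul, stateField_toVac, stateField_toVac, smul_eq_mul, map_mul,
    Module.End.mul_apply, fieldActU_ι, fieldActL_cur]

/-- The vector `J_x = (x t⁻¹)|0⟩`. -/
def curVec : 𝔤 →ₗ[ℂ] Vac B k := (act B k).flip (vac B k) ∘ₗ cur B (-1)

theorem stateField_curVec (x : 𝔤) : stateField B k (curVec B k x) = current B k x := by
  change stateField B k (act B k (cur B (-1) x) (vac B k)) = _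
  rw [stateField_act, stateField_vac, nthProd_neg_one_idField]

end

end

/-! ### Vertex algebras, modules, intertwiners -/

/-- The data of a vertex algebra `V`: its vacuum vector and its state-field correspondence
`Y : V → Hom(V, V((z)))`. The notions of module and intertwiner only refer to these data; they are
used below for the universal affine vertex algebra only. -/
class VertexStructure (V : Type*) [AddCommGroup V] [Module ℂ V] where
  vacuum : V
  Y : V →ₗ[ℂ] VertexOperator ℂ V

/-- A module over the vertex algebra `V`, with its translation operator `T`. The mode `v_(n)` is the
coefficient of `z^(-n-1)` in `Y^M(v, z)`, written `(Y v)[[n]]`. The last axiom is the coefficient of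
`z₁^(-m-1) z₂^(-k-1)` in
`ι_{z₁,z₂} z₁₂ⁿ Y(u,z₁) Y(v,z₂) a - ι_{z₂,z₁} z₁₂ⁿ Y(v,z₂) Y(u,z₁) a
  = ∑_{i ≥ 0} Y(u_(n+i) v, z₂) a ∂_{z₂}^(i) δ(z₁,z₂)`;
all three sums are finite. -/
class VertexModule (V : Type*) [AddCommGroup V] [Module ℂ V] [VertexStructure V]
    (M : Type*) [AddCommGroup M] [Module ℂ M] where
  T : Module.End ℂ M
  Y : V →ₗ[ℂ] VertexOperator ℂ M
  Y_vacuum : Y VertexStructure.vacuum = idField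
  T_Y : ∀ (v : V) (n : ℤ) (a : M),
    T (((Y v)[[n]]) a) - ((Y v)[[n]]) (T a) = (-n : ℂ) • ((Y v)[[n - 1]]) a
  jacobi : ∀ (u v : V) (a : M) (m n k : ℤ),
    (∑ᶠ j : ℕ, ((-1 : ℂ) ^ j * (Ring.choose n j : ℤ)) •
        ((Y u)[[m + n - j]]) (((Y v)[[k + j]]) a)) -
      (∑ᶠ j : ℕ, ((-1 : ℂ) ^ n * ((-1 : ℂ) ^ j * (Ring.choose n j : ℤ))) •
        ((Y v)[[n + k - j]]) (((Y u)[[m + j]]) a)) =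
    ∑ᶠ j : ℕ, ((Ring.choose m j : ℤ) : ℂ) •
      ((Y (((VertexStructure.Y u)[[n + j]]) v))[[m + k - j]]) a

/-- The space `U⟦z⟧z^{-Γ}` of series `∑ f_s z^s`, where `s` runs over a finite union of sets
`-d + ℤ_{≥0}` with `d ∈ Γ`. -/
def GenSeries (Γ : Set ℂ) (U : Type*) [AddCommGroup U] [Module ℂ U] : Submodule ℂ (ℂ → U) where
  carrier := {f | ∃ D : Finset ℂ, (D : Set ℂ) ⊆ Γ ∧ ∀ s, f s ≠ 0 → ∃ d ∈ D, ∃ j : ℕ, s = -d + j}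
  zero_mem' := ⟨∅, by simp, fun s hs => absurd rfl hs⟩
  add_mem' := by
    classical
    rintro f g ⟨D, hD, hf⟩ ⟨E, hE, hg⟩
    refine ⟨D ∪ E, by simp [hD, hE], fun s hs => ?_⟩
    by_cases h : f s = 0
    · obtain ⟨d, hd, h⟩ := hg s (by simpa [h] using hs)
      exact ⟨d, Finset.mem_union_right _ hd, h⟩
    · obtain ⟨d, hd, h⟩ := hf s h
      exact ⟨d, Finset.mem_union_left _ hd, h⟩
  smul_mem' := by
    rintro c f ⟨D, hD, hf⟩
    exact ⟨D, hD, fun s hs => hf s fun h => hs (by simp [h])⟩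

/-- An intertwining operator of type `(M₃; M₁ M₂)`. -/
structure Intertwiner (V : Type*) [AddCommGroup V] [Module ℂ V] [VertexStructure V]
    (M₁ M₂ M₃ : Type*) [AddCommGroup M₁] [Module ℂ M₁] [AddCommGroup M₂] [Module ℂ M₂]
    [AddCommGroup M₃] [Module ℂ M₃] [VertexModule V M₁] [VertexModule V M₂] [VertexModule V M₃] where
  Γ : Set ℂ
  /-- `Γ + ℤ = Γ` -/
  add_int_mem : ∀ s ∈ Γ, ∀ n : ℤ, s + n ∈ Γ
  /-- `Γ/ℤ` is finite -/
  finite_mod_int : ∃ F : Finset ℂ, ∀ s ∈ Γ, ∃ f ∈ F, ∃ n : ℤ, s = f + n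
  /-- `𝒴(a, z) b` -/
  Y : M₁ →ₗ[ℂ] M₂ →ₗ[ℂ] GenSeries Γ M₃
  /-- `[T, 𝒴(a, z)] = 𝒴(T a, z)`, coefficient of `z^s` -/
  T_comm : ∀ (a : M₁) (b : M₂) (s : ℂ),
    VertexModule.T V ((Y a b : ℂ → M₃) s) - (Y a (VertexModule.T V b) : ℂ → M₃) s =
      (Y (VertexModule.T V a) b : ℂ → M₃) s
  /-- `𝒴(T a, z) = D_z 𝒴(a, z)`, coefficient of `z^s` -/
  T_deriv : ∀ (a : M₁) (b : M₂) (s : ℂ),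
    (Y (VertexModule.T V a) b : ℂ → M₃) s = (s + 1) • (Y a b : ℂ → M₃) (s + 1)
  /-- The coefficient of `z₁^(-m-1) z₂^(-k-1)`, for `k ∈ ℂ`, in the Jacobi identity
  `ι_{z₁,z₂} z₁₂ⁿ Y(v,z₁) 𝒴(a,z₂) b - ι_{z₂,z₁} z₁₂ⁿ 𝒴(a,z₂) Y(v,z₁) b
    = ∑_{i ≥ 0} 𝒴(v_(n+i) a, z₂) b ∂_{z₂}^(i) δ(z₁,z₂)`; all three sums are finite. -/
  jacobi : ∀ (v : V) (a : M₁) (b : M₂) (m n : ℤ) (k : ℂ),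
    (∑ᶠ j : ℕ, ((-1 : ℂ) ^ j * (Ring.choose n j : ℤ)) •
        ((VertexModule.Y (M := M₃) v)[[m + n - j]]) ((Y a b : ℂ → M₃) (-(k + j) - 1))) -
      (∑ᶠ j : ℕ, ((-1 : ℂ) ^ n * ((-1 : ℂ) ^ j * (Ring.choose n j : ℤ))) •
        (Y a (((VertexModule.Y (M := M₂) v)[[m + j]]) b) : ℂ → M₃) (-(n + k - j) - 1)) =
    ∑ᶠ j : ℕ, ((Ring.choose m j : ℤ) : ℂ) •
      (Y (((VertexModule.Y (M := M₁) v)[[n + j]]) a) b : ℂ → M₃) (-(m + k - j) - 1)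

/-- The formal Fourier transform `U((z)) → U[λ]`: `z^(-n-1) ↦ λⁿ/n!` for `n ≥ 0`, and
`z^(-n-1) ↦ 0` for `n < 0`. -/
def fourier {U : Type*} [AddCommGroup U] [Module ℂ U] (f : HahnModule ℤ ℂ U) :
    PolynomialModule ℂ U :=
  PolynomialModule.ofCoeff ℂ <| Finsupp.ofSupportFinite
    (fun n : ℕ => ((n.factorial : ℂ)⁻¹) • ((HahnModule.of ℂ).symm f).coeff (-n - 1)) <| by
      refine (Set.finite_Iio (-((HahnModule.of ℂ).symm f).order).toNat).subset fun n hn => ?_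
      by_contra h
      refine hn ?_
      simp only [Set.mem_Iio, not_lt] at h
      dsimp only
      rw [HahnSeries.coeff_eq_zero_of_lt_order (by omega), smul_zero]

section
variable {V : Type*} [AddCommGroup V] [Module ℂ V] [VertexStructure V]

/-- The `λ`-bracket `[v_λ a] ∈ M[λ]` of `v ∈ V` and `a ∈ M`. -/
def lambdaBracket {M : Type*} [AddCommGroup M] [Module ℂ M] [VertexModule V M] (v : V) (a : M) :
    PolynomialModule ℂ M :=
  fourier (VertexModule.Y v a)

variable {M₁ M₂ M₃ : Type*} [AddCommGroup M₁] [Module ℂ M₁] [AddCommGroup M₂] [Module ℂ M₂]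
  [AddCommGroup M₃] [Module ℂ M₃] [VertexModule V M₁] [VertexModule V M₂] [VertexModule V M₃]

/-- The mode `a_(s) b`, `s ∈ ℂ`: the coefficient of `z^(-s-1)` in `𝒴(a, z) b`. It is bilinear in
`a` and `b`. -/
def Intertwiner.mode (𝒴 : Intertwiner V M₁ M₂ M₃) (s : ℂ) : M₁ →ₗ[ℂ] M₂ →ₗ[ℂ] M₃ :=
  𝒴.Y.compr₂ (LinearMap.proj (-s - 1) ∘ₗ (GenSeries 𝒴.Γ M₃).subtype)

/-- The linear map `E₁ ⊗ E₂ → M₃`, `a ⊗ b ↦ a_(s) b`, for subspaces `E₁ ⊆ M₁` and `E₂ ⊆ M₂`. -/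
def Intertwiner.tensorMode (𝒴 : Intertwiner V M₁ M₂ M₃) (s : ℂ) (E₁ : Submodule ℂ M₁)
    (E₂ : Submodule ℂ M₂) : E₁ ⊗[ℂ] E₂ →ₗ[ℂ] M₃ :=
  TensorProduct.lift ((𝒴.mode s).domRestrict₁₂ E₁ E₂)

/-- `m₁, …, m_d ∈ Γ`, pairwise incongruent modulo `ℤ`, are such that
`𝒴(a, z) b = ∑_i ∑_{n ≥ 0} a_(m_i - n) b z^(-m_i + n - 1)` for all `a ∈ A` and `b ∈ B`. -/
structure Intertwiner.IsExpansion (𝒴 : Intertwiner V M₁ M₂ M₃) {d : ℕ} (m : Fin d → ℂ)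
    (A : Set M₁) (B : Set M₂) : Prop where
  mem : ∀ i, m i ∈ 𝒴.Γ
  incongruent : ∀ i j, (∃ n : ℤ, m i - m j = n) → i = j
  support : ∀ a ∈ A, ∀ b ∈ B, ∀ s, 𝒴.mode s a b ≠ 0 → ∃ i, ∃ n : ℕ, s = m i - n

end

/-! ### The universal affine vertex algebra of a simple Lie algebra -/

instance {𝔤 : Type*} [LieRing 𝔤] [LieAlgebra ℂ 𝔤] (B : InvariantForm 𝔤) (k : ℂ) :
    VertexStructure (Vac B k) where
  vacuum := vac B k
  Y := stateField B k

section
variable {𝔤 : Type*} [LieRing 𝔤] [LieAlgebra ℂ 𝔤] [FiniteDimensional ℂ 𝔤] [LieAlgebra.IsSimple ℂ 𝔤]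
  {H : LieSubalgebra ℂ 𝔤} [H.IsCartanSubalgebra]

/-- The dual Coxeter number `h^∨ = 1 + ∑ a_i^∨`, where `θ^∨ = ∑ a_i^∨ α_i^∨` is the expression of
the coroot of the highest root `θ` in the simple coroots. -/
def dualCoxeter (Δ : (LieAlgebra.IsKilling.rootSystem H).Base) (θ : H.root) : ℂ :=
  1 + (Δ.flip.height θ : ℂ)

/-- The form `(x, y) = Tr(ad x ad y) / (2 h^∨)`. -/
def normalizedForm (Δ : (LieAlgebra.IsKilling.rootSystem H).Base) (θ : H.root) :
    InvariantForm 𝔤 where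
  form := (2 * dualCoxeter Δ θ)⁻¹ • killingForm ℂ 𝔤
  invariant x y z := by
    have := LieModule.traceForm_lieInvariant ℂ 𝔤 𝔤 x y z
    simp only [LinearMap.smul_apply]
    rw [this, smul_neg]
  symm := ⟨fun x y => by
    have := (LieModule.traceForm_isSymm ℂ 𝔤 𝔤).eq x y
    simp only [LinearMap.smul_apply, RingHom.id_apply] at *
    rw [this]⟩

/-- The universal affine vertex algebra `V^k(𝔤)`. -/
abbrev UniversalAffine (Δ : (LieAlgebra.IsKilling.rootSystem H).Base) (θ : H.root) (k : ℂ) :=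
  Vac (normalizedForm Δ θ) k

/-- The vector `J_x = (x t⁻¹)|0⟩ ∈ V^k(𝔤)`. -/
abbrev J (Δ : (LieAlgebra.IsKilling.rootSystem H).Base) (θ : H.root) (k : ℂ) (x : 𝔤) :
    UniversalAffine Δ θ k :=
  curVec (normalizedForm Δ θ) k x

/-- The operator `x t^n` on a `V^k(𝔤)`-module, i.e. the mode `(J_x)_(n)`. -/
def loopAct (Δ : (LieAlgebra.IsKilling.rootSystem H).Base) (θ : H.root) (k : ℂ)
    {M : Type*} [AddCommGroup M] [Module ℂ M] [VertexModule (UniversalAffine Δ θ k) M]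
    (x : 𝔤) (n : ℤ) : Module.End ℂ M :=
  (VertexModule.Y (M := M) (J Δ θ k x))[[n]]

/-- The condition `[J_x _λ a] = x a` for all `x ∈ 𝔤`, where `x a = (x t⁰) a`. -/
def SatisfiesSing (Δ : (LieAlgebra.IsKilling.rootSystem H).Base) (θ : H.root) (k : ℂ)
    {M : Type*} [AddCommGroup M] [Module ℂ M] [VertexModule (UniversalAffine Δ θ k) M]
    (a : M) : Prop :=
  ∀ x : 𝔤, lambdaBracket (J Δ θ k x) a = PolynomialModule.single ℂ 0 (loopAct Δ θ k x 0 a)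

end

end

end AffineVertex

open AffineVertex

/-! The whole statement is a consequence of the commutator formula. Taking the exponent of `z₁ - z₂`
to be zero in the Jacobi identity gives `[v_(n), a_(s)] b = ∑_j binom(n, j) (v_(j) a)_(n+s-j) b`. If
`[v_λ a]` is constant in `λ`, only `j = 0` survives, and the sum becomes `(v_(0) a)_(n+s) b`
(`Intertwiner.commutator`).

Now let `s = m_i` and `n ≥ 0`. For `n = 0` the formula says that `v_(0)` acts on `a_(m_i) b` by the
Leibniz rule. For `n > 0` two terms have to vanish. The term `a_(m_i) (v_(n) b)` vanishes because
`[v_λ b]` is constant too. The term `(v_(0) a)_(m_i + n) b` vanishes because `m_i` is the top index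
in its class modulo `ℤ` (`Intertwiner.IsExpansion.mode_add_eq_zero`). This is why the expansion
exponents must serve `x a` as well as `a`, whereas on the side of `M₂` the vector `b` alone is
enough.

Both claims come from `Intertwiner.IsExpansion.lambdaBracket_mode` with `v = J_x`. The second one
extends it from pure tensors by linearity, and then carries the module axioms from `E₁ ⊗ E₂` to the
image of `Φ_i`. -/

namespace AffineVertex

/-! ### Constant `λ`-brackets in terms of modes -/

section
variable {V : Type*} [AddCommGroup V] [Module ℂ V] [VertexStructure V]
  {M : Type*} [AddCommGroup M] [Module ℂ M] [VertexModule V M]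

/-- The coefficient of `λⁿ` is `v_(n) a / n!`, and `n!` is invertible in `ℂ`. Each mode is linear in
`a`, so in this form the condition can be fed to the commutator formula and added up over tensors.
-/
theorem lambdaBracket_eq_single_iff (v : V) (a w : M) :
    lambdaBracket v a = PolynomialModule.single ℂ 0 w ↔
      ((VertexModule.Y (M := M) v)[[0]]) a = w ∧
        ∀ n : ℕ, 0 < n → ((VertexModule.Y (M := M) v)[[(n : ℤ)]]) a = 0 := by
  -- Holds by definition: `fourier` reads off the coefficient of `z^(-n-1)`, which is what the mode
  -- of index `n` is.
  have hc : ∀ n : ℕ, (lambdaBracket v a).coeff n =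
      ((n.factorial : ℂ)⁻¹) • ((VertexModule.Y (M := M) v)[[(n : ℤ)]]) a := fun n => rfl
  rw [← PolynomialModule.coeff_inj, PolynomialModule.coeff_single, Finsupp.ext_iff]
  constructor
  · refine fun h => ⟨by simpa [hc] using h 0, fun n hn => ?_⟩
    have := h n
    rw [hc, Finsupp.single_eq_of_ne (by omega), smul_eq_zero] at this
    exact this.resolve_left (inv_ne_zero (Nat.cast_ne_zero.2 n.factorial_ne_zero))
  · rintro ⟨h0, h⟩ n
    rcases n.eq_zero_or_pos with rfl | hn
    · simpa [hc] using h0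
    · rw [hc, h n hn, smul_zero, Finsupp.single_eq_of_ne (by omega)]

end

/-! ### Commutators of modes with an intertwining operator, and the top modes -/

section
variable {V : Type*} [AddCommGroup V] [Module ℂ V] [VertexStructure V]
  {M₁ M₂ M₃ : Type*} [AddCommGroup M₁] [Module ℂ M₁] [AddCommGroup M₂] [Module ℂ M₂]
  [AddCommGroup M₃] [Module ℂ M₃] [VertexModule V M₁] [VertexModule V M₂] [VertexModule V M₃]

/-- The commutator formula `[v_(m), a_(s)] b = (v_(0) a)_(m + s) b` for `v_(n) a = 0`, `n > 0`. -/
theorem Intertwiner.commutator (𝒴 : Intertwiner V M₁ M₂ M₃) (v : V) (a : M₁) (b : M₂)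
    (ha : ∀ n : ℕ, 0 < n → ((VertexModule.Y (M := M₁) v)[[(n : ℤ)]]) a = 0) (m : ℤ) (s : ℂ) :
    ((VertexModule.Y (M := M₃) v)[[m]]) (𝒴.mode s a b) -
        𝒴.mode s a (((VertexModule.Y (M := M₂) v)[[m]]) b) =
      𝒴.mode (m + s) (((VertexModule.Y (M := M₁) v)[[0]]) a) b := by
  -- `jacobi` is written in exponents of `z`, `mode` in Fourier indices; index `s` is exponent `-s -
  -- 1`.
  have hmode : ∀ (s : ℂ) (a : M₁) (b : M₂), 𝒴.mode s a b = (𝒴.Y a b : ℂ → M₃) (-s - 1) :=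
    fun _ _ _ => rfl
  -- With exponent `0` on `z₁ - z₂` both sums on the left carry the factor `binom(0, j)`, so they
  -- shrink to the two halves of the commutator. The right side keeps the factors `binom(m, j)`.
  have h := 𝒴.jacobi v a b m 0 s
  rw [finsum_eq_single _ 0, finsum_eq_single _ 0, finsum_eq_single _ 0] at h
  · simpa [hmode] using h
  -- The sum on the right side: its terms with `j > 0` contain `v_(j) a = 0`.
  · intro j hj
    rw [zero_add, ha j (by omega)]
    simp
  -- The two sums on the left side: `binom(0, j) = 0` for `j > 0`.
  all_goals
    intro j hj
    rw [Ring.choose_zero_pos ℤ (by omega)]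
    simp

/-- A nonzero mode has an index of the form `m_j - p` with `p ≥ 0`. Such an index is congruent to
`m_i` only for `j = i`, and then it cannot lie above `m_i`. Without pairwise incongruence another
`m_j` could exceed `m_i` by an integer and the vanishing could fail. -/
theorem Intertwiner.IsExpansion.mode_add_eq_zero {𝒴 : Intertwiner V M₁ M₂ M₃} {d : ℕ}
    {m : Fin d → ℂ} {A : Set M₁} {B : Set M₂} (h : 𝒴.IsExpansion m A B) {a : M₁} (ha : a ∈ A)
    {b : M₂} (hb : b ∈ B) (i : Fin d) {n : ℕ} (hn : 0 < n) : 𝒴.mode (n + m i) a b = 0 := by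
  by_contra hne
  obtain ⟨j, p, hp⟩ := h.support a ha b hb _ hne
  -- From `n + m_i = m_j - p` the difference `m_i - m_j` is the integer `-p - n`. Once `j = i`, the
  -- same equation says `n + p = 0`.
  obtain rfl := h.incongruent i j ⟨-p - n, by push_cast; linear_combination hp⟩
  have : ((n + p : ℕ) : ℂ) = 0 := by push_cast; linear_combination hp
  rw [Nat.cast_eq_zero] at this
  omega

/-- If `[v_λ a] = a'` and `[v_λ b] = b'` are constant in `λ`, then
`[v_λ a_(m_i) b] = a'_(m_i) b + a_(m_i) b'`. -/
theorem Intertwiner.IsExpansion.lambdaBracket_mode {𝒴 : Intertwiner V M₁ M₂ M₃} {d : ℕ}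
    {m : Fin d → ℂ} {A : Set M₁} {B : Set M₂} (h : 𝒴.IsExpansion m A B) {v : V} {a a' : M₁}
    {b b' : M₂} (ha : lambdaBracket v a = PolynomialModule.single ℂ 0 a')
    (hb : lambdaBracket v b = PolynomialModule.single ℂ 0 b') (ha' : a' ∈ A) (hbB : b ∈ B)
    (i : Fin d) :
    lambdaBracket v (𝒴.mode (m i) a b) =
      PolynomialModule.single ℂ 0 (𝒴.mode (m i) a' b + 𝒴.mode (m i) a b') := by
  rw [lambdaBracket_eq_single_iff] at ha hb ⊢
  refine ⟨?_, fun n hn => ?_⟩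
  -- The zero mode does not shift the index, so the commutator is the Leibniz rule at `m_i`.
  · have := 𝒴.commutator v a b ha.2 0 (m i)
    rw [ha.1, hb.1, Int.cast_zero, zero_add] at this
    exact sub_eq_iff_eq_add.1 this
  -- For `n > 0`, `v_(n) b = 0` removes the second half of the commutator, and the right side `a'_(n
  -- + m_i) b` lies above the top index. Only `a'`, not `a`, has to belong to `A` here.
  · have := 𝒴.commutator v a b ha.2 n (m i)
    rwa [ha.1, hb.2 n hn, map_zero, sub_zero, Int.cast_natCast,
      h.mode_add_eq_zero ha' hbB i hn] at this

end

end AffineVertex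

/-! ### Transport of a Lie module structure to an image -/

/-- The image of a linear map from a Lie module is a Lie module, if the action descends to it. -/
theorem LinearMap.exists_lieModule_range {R L N P : Type*} [CommRing R] [LieRing L]
    [LieAlgebra R L] [AddCommGroup N] [Module R N] [LieRingModule L N] [LieModule R L N]
    [AddCommGroup P] [Module R P] (f : N →ₗ[R] P) (ρ : L → P →ₗ[R] P)
    (hρ : ∀ x t, ρ x (f t) = f ⁅x, t⁆) :
    ∃ (_ : LieRingModule L (LinearMap.range f)) (_ : LieModule R L (LinearMap.range f)),
      ∀ (x : L) (t : N), ⁅x, f.rangeRestrict t⁆ = f.rangeRestrict ⁅x, t⁆ := by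
  have hmem : ∀ x, ∀ w ∈ LinearMap.range f, ρ x w ∈ LinearMap.range f := by
    rintro x _ ⟨t, rfl⟩
    exact ⟨_, (hρ x t).symm⟩
  -- The bracket is defined by restricting `ρ x` rather than by choosing preimages, so
  -- well-definedness is free: `hρ` forces the kernel of `f` to be stable under `L`. No
  -- compatibility of `ρ` with sums or brackets in `L` is assumed on `P`.
  let br : L → LinearMap.range f → LinearMap.range f := fun x w => ⟨ρ x w, hmem x w w.2⟩
  have hbr : ∀ x t, br x (f.rangeRestrict t) = f.rangeRestrict ⁅x, t⁆ := fun x t =>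
    Subtype.ext (hρ x t)
  -- Every vector of the image is some `f t`, so by `hbr` each module axiom reduces to the same
  -- axiom in `N`.
  have hs := f.surjective_rangeRestrict
  let I : LieRingModule L (LinearMap.range f) :=
    { bracket := br
      add_lie := fun x y w => by
        obtain ⟨t, rfl⟩ := hs w
        change br _ _ = br _ _ + br _ _
        simp only [hbr, add_lie, map_add]
      lie_add := fun x w w' => by
        obtain ⟨t, rfl⟩ := hs w
        obtain ⟨t', rfl⟩ := hs w'
        change br _ _ = br _ _ + br _ _
        rw [← map_add, hbr, hbr, hbr, lie_add, map_add]
      leibniz_lie := fun x y w => by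
        obtain ⟨t, rfl⟩ := hs w
        change br _ (br _ _) = br _ _ + br _ (br _ _)
        simp only [hbr]
        rw [leibniz_lie, map_add] }
  refine ⟨I, ⟨fun c x w => ?_, fun c x w => ?_⟩, hbr⟩
  · obtain ⟨t, rfl⟩ := hs w
    change br _ _ = c • br _ _
    simp only [hbr, smul_lie, map_smul]
  · obtain ⟨t, rfl⟩ := hs w
    change br _ _ = c • br _ _
    rw [← map_smul, hbr, hbr, lie_smul, map_smul]

/-- In the second half the `𝔤`-structures on `E₁` and `E₂` are arbitrary data, tied to the modes of
`J_x` by the bracket hypotheses. The structure on the image is existential, but the last formula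
determines its bracket because `rangeRestrict` is surjective; by the constant term of the first
formula it is the action of `x t⁰`. -/
theorem lemma4p5 {𝔤 : Type*} [LieRing 𝔤] [LieAlgebra ℂ 𝔤] [FiniteDimensional ℂ 𝔤]
    [LieAlgebra.IsSimple ℂ 𝔤] (H : LieSubalgebra ℂ 𝔤) [H.IsCartanSubalgebra]
    (Δ : (LieAlgebra.IsKilling.rootSystem H).Base)
    (θ : H.root) (hθ : ∀ β : H.root, Δ.height β ≤ Δ.height θ) (k : ℂ)
    {M₁ M₂ M₃ : Type*} [AddCommGroup M₁] [Module ℂ M₁] [AddCommGroup M₂] [Module ℂ M₂]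
    [AddCommGroup M₃] [Module ℂ M₃]
    [VertexModule (UniversalAffine Δ θ k) M₁] [VertexModule (UniversalAffine Δ θ k) M₂]
    [VertexModule (UniversalAffine Δ θ k) M₃]
    (𝒴 : Intertwiner (UniversalAffine Δ θ k) M₁ M₂ M₃) {d : ℕ} (m : Fin d → ℂ) :
    (∀ (a : M₁) (b : M₂), SatisfiesSing Δ θ k a → SatisfiesSing Δ θ k b →
      𝒴.IsExpansion m ({a} ∪ Set.range fun x : 𝔤 => loopAct Δ θ k x 0 a) {b} →
      ∀ i, SatisfiesSing Δ θ k (𝒴.mode (m i) a b) ∧ ∀ x : 𝔤,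
        lambdaBracket (J Δ θ k x) (𝒴.mode (m i) a b) = PolynomialModule.single ℂ 0
          (𝒴.mode (m i) (loopAct Δ θ k x 0 a) b + 𝒴.mode (m i) a (loopAct Δ θ k x 0 b)) ∧
        loopAct Δ θ k x 0 (𝒴.mode (m i) a b) =
          𝒴.mode (m i) (loopAct Δ θ k x 0 a) b + 𝒴.mode (m i) a (loopAct Δ θ k x 0 b)) ∧
    (∀ (E₁ : Submodule ℂ M₁) (E₂ : Submodule ℂ M₂) [LieRingModule 𝔤 E₁] [LieModule ℂ 𝔤 E₁]
      [LieRingModule 𝔤 E₂] [LieModule ℂ 𝔤 E₂],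
      (∀ (x : 𝔤) (a : E₁), lambdaBracket (J Δ θ k x) (a : M₁) =
        PolynomialModule.single ℂ 0 (⁅x, a⁆ : E₁).1) →
      (∀ (x : 𝔤) (b : E₂), lambdaBracket (J Δ θ k x) (b : M₂) =
        PolynomialModule.single ℂ 0 (⁅x, b⁆ : E₂).1) →
      𝒴.IsExpansion m E₁ E₂ →
      ∀ i : Fin d,
        (∀ (x : 𝔤) (t : E₁ ⊗[ℂ] E₂), lambdaBracket (J Δ θ k x) (𝒴.tensorMode (m i) E₁ E₂ t) =
          PolynomialModule.single ℂ 0 (𝒴.tensorMode (m i) E₁ E₂ ⁅x, t⁆)) ∧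
        ∃ (_ : LieRingModule 𝔤 (LinearMap.range (𝒴.tensorMode (m i) E₁ E₂)))
          (_ : LieModule ℂ 𝔤 (LinearMap.range (𝒴.tensorMode (m i) E₁ E₂))),
          ∀ (x : 𝔤) (t : E₁ ⊗[ℂ] E₂), ⁅x, (𝒴.tensorMode (m i) E₁ E₂).rangeRestrict t⁆ =
            (𝒴.tensorMode (m i) E₁ E₂).rangeRestrict ⁅x, t⁆) := by
  refine ⟨fun a b ha hb h i => ?_, fun E₁ E₂ _ _ _ _ h₁ h₂ h i => ?_⟩
  -- The vector playing the role of `a'` is `x a`, which lies in the second part of the set of the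
  -- expansion hypothesis.
  · have key : ∀ x : 𝔤, _ := fun x =>
      h.lambdaBracket_mode (ha x) (hb x) (Or.inr ⟨x, rfl⟩) rfl i
    have key0 : ∀ x : 𝔤, loopAct Δ θ k x 0 (𝒴.mode (m i) a b) = _ := fun x =>
      ((lambdaBracket_eq_single_iff _ _ _).1 (key x)).1
    -- `(*)` asks for the constant to be `x (a_(m_i) b)` itself; `key0` identifies this with the
    -- Leibniz expression.
    exact ⟨fun x => by rw [key0]; exact key x, fun x => ⟨key x, key0 x⟩⟩
  · have key : ∀ (x : 𝔤) (t : E₁ ⊗[ℂ] E₂),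
        lambdaBracket (J Δ θ k x) (𝒴.tensorMode (m i) E₁ E₂ t) =
          PolynomialModule.single ℂ 0 (𝒴.tensorMode (m i) E₁ E₂ ⁅x, t⁆) := by
      intro x t
      induction t with
      | zero =>
        rw [lie_zero, map_zero, lambdaBracket_eq_single_iff]
        simp
      | tmul a b =>
        rw [TensorProduct.LieModule.lie_tmul_right, map_add]
        -- On a pure tensor `tensorMode` is `mode` by definition. The membership required of `x a`
        -- is the stability of `E₁` under `𝔤`.
        exact h.lambdaBracket_mode (h₁ x a) (h₂ x b) (⁅x, a⁆ : E₁).2 b.2 i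
      | add t u ht hu =>
        -- Additivity is checked mode by mode, where it is linearity of the operators `(J_x)_(n)`.
        rw [lambdaBracket_eq_single_iff] at ht hu ⊢
        simp only [lie_add, map_add]
        exact ⟨by rw [ht.1, hu.1], fun n hn => by rw [ht.2 n hn, hu.2 n hn, add_zero]⟩
    -- The operators `x t⁰` on `M₃` serve as `ρ`, and the constant term of `key` is the required
    -- intertwining relation. The module axioms come from `E₁ ⊗ E₂`, so the commutation relations of
    -- `𝔤̂` on `M₃` are not needed.
    exact ⟨key, LinearMap.exists_lieModule_range _ (fun x => loopAct Δ θ k x 0) fun x t =>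
      ((lambdaBracket_eq_single_iff _ _ _).1 (key x t)).1⟩
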